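/- Let $E,V$ be finite-dimensional real inner product spaces (e.g. $\mathbb R^n,\mathbb R^m$), $A:E\to V$ linear with operator norm $\|A\|$ and adjoint $A^\top$. Let $f:E\to(-\infty,+\infty]$ be proper, closed and $\sigma$-strongly convex with $\sigma>0$, and let $g:V\to(-\infty,+\infty]$ be proper, closed and convex. Assume that $g$ is subdifferentiable at every point of $V$ and that $\gamma_g:=\sup_{z\in V}\sup_{d\in\partial g(z)}\|d\|<\infty$. Put $$H(x)=f(x)+g(Ax),\qquad q(y)=\inf_{x,z}\{f(x)+g(z)-\langle y,Ax-z\rangle\},$$ $$F(y)=f^*(A^\top y),\quad G(y)=g^*(-y),\quad \tilde q=F+G=-q,\quad L_F=\|A\|^2/\sigma,$$ where $f^*,g^*$ are the convex conjugates, and $$Q_L(y,w)=F(w)+\langle y-w,\nabla F(w)\rangle+\tfrac L2\|y-w\|^2+G(y),\qquad p_L(w)=\operatorname*{argmin}_y Q_L(y,w),\qquad x(y)=\operatorname*{argmax}_x\{\langle A^\top y,x\rangle-f(x)\}.$$ Let $y_*$ be any maximizer of $q$. Let $0<L_0\le L_1\le L_2\le\cdots$ and let $\{y_k\}$ be generated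 by one of the following methods. * DPG: $y_k=p_{L_k}(y_{k-1})$, where $\tilde q(p_{L_k}(y_{k-1}))\le Q_{L_k}(p_{L_k}(y_{k-1}),y_{k-1})$, for $k\ge1$. * FDPG: $w_0=y_0$, $t_0=1$ and, for $k\ge1$, $y_k=p_{L_k}(w_{k-1})$, where $\tilde q(p_{L_k}(w_{k-1}))\le Q_{L_k}(p_{L_k}(w_{k-1}),w_{k-1})$, $t_k=\frac{1+\sqrt{1+4t_{k-1}^2}}2$, $w_k=y_k+\frac{t_{k-1}-1}{t_k}(y_k-y_{k-1})$. Then for every $k\ge1$ and every $L_k'\ge L_k$ with $\tilde q(p_{L_k'}(y_k))\le Q_{L_k'}(p_{L_k'}(y_k),y_k)$, the point $x(p_{L_k'}(y_k))$ exists and is unique, and $$H(x(p_{L_k'}(y_k)))-q(p_{L_k'}(y_k))\le(L_k'+L_F)\,(\|y_0-y_*\|+\|y_*\|+\gamma_g)\,\frac{2\|y_0-y_*\|}{k}.$$ The same bound holds for $H(x(p_{L_k'}(y_k)))-H(x_*)$ if $x_*$ minimizes $H$. In particular, for DPG, taking $L_k'=L_{k+1}$ (so that $p_{L_k'}(y_k)=y_{k+1}$),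 for every $k\ge1$ both $H(x(y_{k+1}))-q(y_{k+1})$ and $H(x(y_{k+1}))-H(x_*)$ are at most $$(L_{k+1}+L_F)\,(\|y_0-y_*\|+\|y_*\|+\gamma_g)\,\frac{2\|y_0-y_*\|}{k}.$$ -/

import Mathlib

noncomputable section

namespace DualProx

open Set

variable {E V : Type*} [NormedAddCommGroup E] [InnerProductSpace ℝ E] [CompleteSpace E]
  [NormedAddCommGroup V] [InnerProductSpace ℝ V] [CompleteSpace V]

/-- An extended real-valued function is proper if it never takes the value `-∞`
and is not identically `+∞`. -/
def IsProper (h : E → EReal) : Prop :=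
  (∀ x, h x ≠ ⊥) ∧ ∃ x, h x ≠ ⊤

/-- `σ`-strong convexity of an extended real-valued function (`σ = 0` is plain convexity):
`h (a x + b u) ≤ a h(x) + b h(u) - (σ/2) a b ‖x - u‖²` whenever `a, b ≥ 0`, `a + b = 1`.
The values `h x`, `h u` are read through real upper bounds, so nothing is demanded where
one of them is `+∞`. -/
def IsStronglyConvex (σ : ℝ) (h : E → EReal) : Prop :=
  ∀ (x u : E) (r s a b : ℝ), h x ≤ (r : EReal) → h u ≤ (s : EReal) →
    0 ≤ a → 0 ≤ b → a + b = 1 →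
    h (a • x + b • u) ≤ ((a * r + b * s - σ / 2 * (a * b) * ‖x - u‖ ^ 2 : ℝ) : EReal)

/-- The subdifferential `∂h(z)`. -/
def subdiff (h : E → EReal) (z : E) : Set E :=
  {d | ∀ u, h z + ((inner ℝ d (u - z) : ℝ) : EReal) ≤ h u}

/-- The convex conjugate `h^*`. -/
def conj (h : E → EReal) (u : E) : EReal :=
  ⨆ x, (((inner ℝ u x : ℝ) : EReal) - h x)

/-- The set of norms of all subgradients of `g`. -/
def subgradNorms (g : V → EReal) : Set ℝ :=
  {r | ∃ z, ∃ d ∈ subdiff g z, r = ‖d‖}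

/-- `g` is subdifferentiable everywhere and its subgradients are bounded. -/
def BoundedSubgradients (g : V → EReal) : Prop :=
  (∀ z, (subdiff g z).Nonempty) ∧ BddAbove (subgradNorms g)

/-- `γ_g`, the supremum of the norms of the subgradients of `g`. -/
def gammaG (g : V → EReal) : ℝ := sSup (subgradNorms g)

/-- The primal objective `H(x) = f(x) + g(Ax)`. -/
def primalObj (f : E → EReal) (g : V → EReal) (A : E →L[ℝ] V) (x : E) : EReal :=
  f x + g (A x)

/-- The dual function `q(y) = inf_{x,z} f(x) + g(z) - ⟨y, Ax - z⟩`. -/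
def dualFun (f : E → EReal) (g : V → EReal) (A : E →L[ℝ] V) (y : V) : EReal :=
  ⨅ (x : E) (z : V), (f x + g z - ((inner ℝ y (A x - z) : ℝ) : EReal))

/-- `F(y) = f^*(Aᵀ y)`. -/
def dualF (f : E → EReal) (A : E →L[ℝ] V) (y : V) : EReal :=
  conj f (ContinuousLinearMap.adjoint A y)

/-- `G(y) = g^*(-y)`. -/
def dualG (g : V → EReal) (y : V) : EReal := conj g (-y)

/-- `q̃ = F + G`. -/
def dualObj (f : E → EReal) (g : V → EReal) (A : E →L[ℝ] V) (y : V) : EReal :=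
  dualF f A y + dualG g y

/-- `∇F(w)`; `F` is finite and differentiable everywhere when `f` is proper, closed and
strongly convex. -/
def gradF (f : E → EReal) (A : E →L[ℝ] V) (w : V) : V :=
  gradient (fun y => (dualF f A y).toReal) w

/-- `Q_L(y, w) = F(w) + ⟨y - w, ∇F(w)⟩ + (L/2) ‖y - w‖² + G(y)`. -/
def quadModel (f : E → EReal) (g : V → EReal) (A : E →L[ℝ] V) (L : ℝ) (y w : V) : EReal :=
  dualF f A w + ((inner ℝ (y - w) (gradF f A w) + L / 2 * ‖y - w‖ ^ 2 : ℝ) : EReal) + dualG g y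

/-- `p = p_L(w)`, i.e. `p` minimizes `Q_L(·, w)`. -/
def IsProxGrad (f : E → EReal) (g : V → EReal) (A : E →L[ℝ] V) (L : ℝ) (w p : V) : Prop :=
  IsMinOn (fun y => quadModel f g A L y w) univ p

/-- The step `p = p_L(w)` together with `q̃(p_L(w)) ≤ Q_L(p_L(w), w)`. -/
def IsAcceptedStep (f : E → EReal) (g : V → EReal) (A : E →L[ℝ] V) (L : ℝ) (w p : V) : Prop :=
  IsProxGrad f g A L w p ∧ dualObj f g A p ≤ quadModel f g A L p w

/-- `x = x(y)`, i.e. `x` maximizes `⟨Aᵀ y, ·⟩ - f`. -/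
def IsPrimalPoint (f : E → EReal) (A : E →L[ℝ] V) (y : V) (x : E) : Prop :=
  IsMaxOn (fun u => ((inner ℝ (ContinuousLinearMap.adjoint A y) u : ℝ) : EReal) - f u) univ x

/-- The dual proximal gradient method, with step parameters `L k`. -/
structure IsDPG (f : E → EReal) (g : V → EReal) (A : E →L[ℝ] V) (L : ℕ → ℝ) (y : ℕ → V) :
    Prop where
  L_pos : 0 < L 0
  L_mono : ∀ k, L k ≤ L (k + 1)
  step : ∀ k, IsAcceptedStep f g A (L (k + 1)) (y k) (y (k + 1))

/-- The fast dual proximal gradient method, with step parameters `L k`. -/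
structure IsFDPG (f : E → EReal) (g : V → EReal) (A : E →L[ℝ] V) (L : ℕ → ℝ) (y w : ℕ → V)
    (t : ℕ → ℝ) : Prop where
  L_pos : 0 < L 0
  L_mono : ∀ k, L k ≤ L (k + 1)
  w_zero : w 0 = y 0
  t_zero : t 0 = 1
  step : ∀ k, IsAcceptedStep f g A (L (k + 1)) (w k) (y (k + 1))
  t_succ : ∀ k, t (k + 1) = (1 + √(1 + 4 * t k ^ 2)) / 2
  w_succ : ∀ k, w (k + 1) = y (k + 1) + ((t k - 1) / t (k + 1)) • (y (k + 1) - y k)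

/-- `L_F = ‖A‖² / σ`. -/
def lipF (A : E →L[ℝ] V) (σ : ℝ) : ℝ := ‖A‖ ^ 2 / σ

/-- `(L' + L_F) (‖y₀ - y_*‖ + ‖y_*‖ + γ_g) · 2 ‖y₀ - y_*‖ / k`. -/
def gapBound (g : V → EReal) (A : E →L[ℝ] V) (σ L' : ℝ) (y₀ ystar : V) (k : ℕ) : ℝ :=
  (L' + lipF A σ) * (‖y₀ - ystar‖ + ‖ystar‖ + gammaG g) * (2 * ‖y₀ - ystar‖ / k)

/-- The primal point `x(p)` exists and is unique, and both the primal-dual gap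
`H(x(p)) - q(p)` and the primal error `H(x(p)) - H(x_*)` are at most `B`. -/
def GapLE (f : E → EReal) (g : V → EReal) (A : E →L[ℝ] V) (p : V) (B : ℝ) : Prop :=
  (∃! x, IsPrimalPoint f A p x) ∧
  ∀ x, IsPrimalPoint f A p x →
    primalObj f g A x - dualFun f g A p ≤ (B : EReal) ∧
    ∀ xstar, IsMinOn (primalObj f g A) univ xstar →
      primalObj f g A x - primalObj f g A xstar ≤ (B : EReal)

end DualProx

end

namespace DualProx

open Set

section Abstract

variable {V : Type*} [NormedAddCommGroup V]

/-- The basic inequality satisfied by an accepted proximal gradient step from `w` to `p` with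
step parameter `l`, for the real objective `q` with effective domain `D`. -/
def StepIneq (q : V → ℝ) (D : Set V) (l : ℝ) (w p : V) : Prop :=
  p ∈ D ∧ ∀ y ∈ D, q p + l / 2 * (‖p - y‖ ^ 2 - ‖w - y‖ ^ 2) ≤ q y

theorem StepIneq.div {q : V → ℝ} {D : Set V} {l : ℝ} {w p : V} (h : StepIneq q D l w p)
    (hl : 0 < l) {y : V} (hy : y ∈ D) :
    (‖p - y‖ ^ 2 - ‖w - y‖ ^ 2) / 2 ≤ (q y - q p) * l⁻¹ := by
  have h1 := h.2 y hy
  rw [← div_eq_mul_inv, le_div_iff₀ hl]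
  linarith

theorem StepIneq.dist_le {q : V → ℝ} {D : Set V} {l : ℝ} {w p : V} (h : StepIneq q D l w p)
    (hl : 0 < l) {y : V} (hy : y ∈ D) (hmin : ∀ z ∈ D, q y ≤ q z) : ‖p - y‖ ≤ ‖w - y‖ := by
  have h1 := h.div hl hy
  have h2 : (q y - q p) * l⁻¹ ≤ 0 :=
    mul_nonpos_of_nonpos_of_nonneg (sub_nonpos.2 (hmin p h.1)) (inv_nonneg.2 hl.le)
  exact (sq_le_sq₀ (norm_nonneg _) (norm_nonneg _)).1 (by linarith)

/-- Telescoped comparison of the last step with the point `y n`. -/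
theorem window_ineq {q : V → ℝ} {D : Set V} {l : ℕ → ℝ} (hl : ∀ i, 0 < l i) {y : ℕ → V} {k n : ℕ}
    (hn : n ≤ k) (hstep : ∀ i ≤ k, StepIneq q D (l i) (y i) (y (i + 1))) (hyn : y n ∈ D) :
    2 * ∑ i ∈ Finset.Ico n k, (q (y (i + 1)) - q (y (k + 1))) * (l i)⁻¹
        + ‖y (k + 1) - y k‖ ^ 2 / 2 ≤
      (q (y n) - q (y (k + 1))) * ∑ j ∈ Finset.Ico n (k + 1), (l j)⁻¹ := by
  have hA : ∑ i ∈ Finset.Ico n k, (q (y (i + 1)) - q (y (k + 1))) * (l i)⁻¹ ≤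
      ∑ i ∈ Finset.Ico n k, (-(‖y (i + 1) - y (k + 1)‖ ^ 2 / 2) - -(‖y i - y (k + 1)‖ ^ 2 / 2)) := by
    refine Finset.sum_le_sum fun i hi => ?_
    have h1 := (hstep i (Finset.mem_Ico.1 hi).2.le).div (hl i) (hstep k le_rfl).1
    linarith
  have hB : ∑ i ∈ Finset.Ico n (k + 1), (‖y (i + 1) - y n‖ ^ 2 / 2 - ‖y i - y n‖ ^ 2 / 2) ≤
      ∑ i ∈ Finset.Ico n (k + 1), (q (y n) - q (y (i + 1))) * (l i)⁻¹ := by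
    refine Finset.sum_le_sum fun i hi => ?_
    have h1 := (hstep i (Nat.lt_succ_iff.1 (Finset.mem_Ico.1 hi).2)).div (hl i) hyn
    linarith
  rw [Finset.sum_Ico_sub (fun i => -(‖y i - y (k + 1)‖ ^ 2 / 2)) hn] at hA
  rw [Finset.sum_Ico_sub (fun i => ‖y i - y n‖ ^ 2 / 2) (by omega)] at hB
  have hC : ∑ i ∈ Finset.Ico n (k + 1), (q (y n) - q (y (i + 1))) * (l i)⁻¹ =
      (q (y n) - q (y (k + 1))) * ∑ j ∈ Finset.Ico n (k + 1), (l j)⁻¹ -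
      ∑ i ∈ Finset.Ico n k, (q (y (i + 1)) - q (y (k + 1))) * (l i)⁻¹ := by
    have : ∑ i ∈ Finset.Ico n k, (q (y (i + 1)) - q (y (k + 1))) * (l i)⁻¹ =
        ∑ i ∈ Finset.Ico n (k + 1), (q (y (i + 1)) - q (y (k + 1))) * (l i)⁻¹ := by
      rw [Finset.sum_Ico_succ_top hn]; simp
    rw [this, Finset.mul_sum, ← Finset.sum_sub_distrib]
    exact Finset.sum_congr rfl fun i _ => by ring
  rw [norm_sub_rev (y k), norm_sub_rev (y n)] at hA
  simp only [sub_self, norm_zero] at hB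
  linarith

theorem weighted_sum_ge {q : V → ℝ} {D : Set V} {l : ℕ → ℝ} (hl : ∀ i, 0 < l i)
    (hmono : Monotone l) {y : ℕ → V} {k : ℕ}
    (hstep : ∀ i ≤ k, StepIneq q D (l i) (y i) (y (i + 1))) (t : ℕ) :
    ∀ n, n + t = k → ‖y (k + 1) - y k‖ ^ 2 * ((t : ℝ) ^ 2 + 3 * t) / 8 ≤
      ∑ i ∈ Finset.Ico n k, (q (y (i + 1)) - q (y (k + 1))) * (l i)⁻¹ := by
  induction t with
  | zero => rintro n rfl; simp
  | succ t ih =>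
    intro n hn
    have hW := ih (n + 1) (by omega)
    have hwin := window_ineq hl (n := n + 1) (by omega) hstep (hstep n (by omega)).1
    rw [Finset.sum_eq_sum_Ico_succ_bot (by omega)]
    set W := ∑ i ∈ Finset.Ico (n + 1) k, (q (y (i + 1)) - q (y (k + 1))) * (l i)⁻¹
    set s := ‖y (k + 1) - y k‖ ^ 2
    set U := q (y (n + 1)) - q (y (k + 1))
    have hs : 0 ≤ s := by positivity
    have hW0 : 0 ≤ W := le_trans (by positivity) hW
    have hS : ∑ j ∈ Finset.Ico (n + 1) (k + 1), (l j)⁻¹ ≤ ((t : ℝ) + 1) * (l n)⁻¹ := by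
      have := Finset.sum_le_card_nsmul (Finset.Ico (n + 1) (k + 1)) (fun j => (l j)⁻¹) (l n)⁻¹
        fun j hj => inv_anti₀ (hl n) (hmono (by have := (Finset.mem_Ico.1 hj).1; omega))
      rw [Nat.card_Ico, nsmul_eq_mul, show k + 1 - (n + 1) = t + 1 by omega] at this
      exact_mod_cast this
    have hSpos : 0 < ∑ j ∈ Finset.Ico (n + 1) (k + 1), (l j)⁻¹ :=
      Finset.sum_pos (fun j _ => inv_pos.2 (hl j)) ⟨n + 1, Finset.mem_Ico.2 (by omega)⟩
    have hU : 0 ≤ U := by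
      by_contra! h
      have := mul_neg_of_neg_of_pos h hSpos
      linarith
    have h2 : 2 * W + s / 2 ≤ U * (((t : ℝ) + 1) * (l n)⁻¹) :=
      hwin.trans (mul_le_mul_of_nonneg_left hS hU)
    have ht : (0 : ℝ) < t + 1 := by positivity
    have h3 : ((t : ℝ) + 3) * (s * ((t : ℝ) ^ 2 + 3 * t) / 8) ≤ ((t : ℝ) + 3) * W :=
      mul_le_mul_of_nonneg_left hW (by positivity)
    push_cast
    refine le_of_mul_le_mul_left ?_ ht
    linarith

theorem sum_gap_le {q : V → ℝ} {D : Set V} {l : ℕ → ℝ} (hl : ∀ i, 0 < l i) {y : ℕ → V} {k : ℕ}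
    (hstep : ∀ i < k, StepIneq q D (l i) (y i) (y (i + 1))) {ys : V} (hys : ys ∈ D) :
    ∑ i ∈ Finset.Ico 0 k, (q (y (i + 1)) - q ys) * (l i)⁻¹ ≤ ‖y 0 - ys‖ ^ 2 / 2 := by
  have hA : ∑ i ∈ Finset.Ico 0 k, (q (y (i + 1)) - q ys) * (l i)⁻¹ ≤
      ∑ i ∈ Finset.Ico 0 k, (-(‖y (i + 1) - ys‖ ^ 2 / 2) - -(‖y i - ys‖ ^ 2 / 2)) := by
    refine Finset.sum_le_sum fun i hi => ?_
    have h1 := (hstep i (Finset.mem_Ico.1 hi).2).div (hl i) hys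
    linarith
  rw [Finset.sum_Ico_sub (fun i => -(‖y i - ys‖ ^ 2 / 2)) (Nat.zero_le k)] at hA
  have : 0 ≤ ‖y k - ys‖ ^ 2 := by positivity
  linarith

theorem dist_le_of_steps {q : V → ℝ} {D : Set V} {l : ℕ → ℝ} (hl : ∀ i, 0 < l i) {y : ℕ → V}
    {ys : V} (hys : ys ∈ D) (hmin : ∀ z ∈ D, q ys ≤ q z) (k : ℕ)
    (hstep : ∀ i < k, StepIneq q D (l i) (y i) (y (i + 1))) : ‖y k - ys‖ ≤ ‖y 0 - ys‖ := by
  induction k with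
  | zero => exact le_rfl
  | succ k ih =>
    exact ((hstep k (by omega)).dist_le (hl k) hys hmin).trans (ih fun i hi => hstep i (by omega))

/-- The displacement of the proximal gradient method decays like `1 / k`. -/
theorem displacement_le {q : V → ℝ} {D : Set V} {l : ℕ → ℝ} (hl : ∀ i, 0 < l i)
    (hmono : Monotone l) {y : ℕ → V} {k : ℕ} (hk : 1 ≤ k)
    (hstep : ∀ i ≤ k, StepIneq q D (l i) (y i) (y (i + 1))) {ys : V} (hys : ys ∈ D)
    (hmin : ∀ z ∈ D, q ys ≤ q z) :
    ‖y (k + 1) - y k‖ ≤ 2 * ‖y 0 - ys‖ / k := by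
  have h1 := weighted_sum_ge hl hmono hstep k 0 (by omega)
  have h2 := sum_gap_le hl (fun i hi => hstep i hi.le) hys (k := k)
  have h3 : ∑ i ∈ Finset.Ico 0 k, (q (y (i + 1)) - q (y (k + 1))) * (l i)⁻¹ ≤
      ∑ i ∈ Finset.Ico 0 k, (q (y (i + 1)) - q ys) * (l i)⁻¹ :=
    Finset.sum_le_sum fun i _ => mul_le_mul_of_nonneg_right
      (sub_le_sub_left (hmin _ (hstep k le_rfl).1) _) (inv_nonneg.2 (hl i).le)
  have hk0 : (0 : ℝ) < k := by exact_mod_cast hk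
  rw [le_div_iff₀ hk0]
  refine (sq_le_sq₀ (by positivity) (by positivity)).1 ?_
  have h4 : 0 ≤ ‖y (k + 1) - y k‖ ^ 2 * k := by positivity
  rw [mul_pow, mul_pow]
  linarith

variable [InnerProductSpace ℝ V]

theorem extrapolation_identity (a b : V) (T : ℝ) :
    T * (T - 1) * ‖a - b‖ ^ 2 + T * ‖a‖ ^ 2 = ‖T • a - (T - 1) • b‖ ^ 2 + (T - 1) * ‖b‖ ^ 2 := by
  rw [norm_sub_sq_real, norm_sub_sq_real, norm_smul, norm_smul, inner_smul_left, inner_smul_right,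
    mul_pow, mul_pow, Real.norm_eq_abs, Real.norm_eq_abs, sq_abs, sq_abs]
  simp only [conj_trivial]
  ring

section Fast

variable {q : V → ℝ} {D : Set V} {l t : ℕ → ℝ} {y w : ℕ → V}

theorem momentum_sq (ht : ∀ k, t (k + 1) = (1 + √(1 + 4 * t k ^ 2)) / 2) (k : ℕ) :
    t (k + 1) * (t (k + 1) - 1) = t k ^ 2 := by
  have := Real.sq_sqrt (show 0 ≤ 1 + 4 * t k ^ 2 by positivity)
  rw [ht]
  linarith

theorem momentum_ge (ht0 : t 0 = 1) (ht : ∀ k, t (k + 1) = (1 + √(1 + 4 * t k ^ 2)) / 2) (k : ℕ) :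
    ((k : ℝ) + 2) / 2 ≤ t k := by
  induction k with
  | zero => simp [ht0]
  | succ k ih =>
    have h1 : 2 * t k ≤ √(1 + 4 * t k ^ 2) := Real.le_sqrt_of_sq_le (by linarith)
    rw [ht]
    push_cast
    linarith

theorem fast_potential (hl : ∀ i, 0 < l i) (hmono : Monotone l) (hw0 : w 0 = y 0) (ht0 : t 0 = 1)
    (ht : ∀ k, t (k + 1) = (1 + √(1 + 4 * t k ^ 2)) / 2)
    (hw : ∀ k, w (k + 1) = y (k + 1) + ((t k - 1) / t (k + 1)) • (y (k + 1) - y k))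
    (hstep : ∀ k, StepIneq q D (l k) (w k) (y (k + 1))) {ys : V} (hys : ys ∈ D)
    (hmin : ∀ z ∈ D, q ys ≤ q z) (k : ℕ) :
    2 * t k ^ 2 * ((q (y (k + 1)) - q ys) * (l k)⁻¹) +
      ‖t k • (y (k + 1) - ys) - (t k - 1) • (y k - ys)‖ ^ 2 ≤ ‖y 0 - ys‖ ^ 2 := by
  induction k with
  | zero =>
    have := (hstep 0).div (hl 0) hys
    rw [hw0] at this
    simp only [ht0, one_smul, sub_self, zero_smul, sub_zero]
    linarith
  | succ k ih =>
    have hT : 1 ≤ t (k + 1) := by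
      have := momentum_ge ht0 ht (k + 1)
      push_cast at this
      have : (0 : ℝ) ≤ k := by positivity
      linarith
    have hsq := momentum_sq ht k
    have e1 := extrapolation_identity (y (k + 2) - ys) (y (k + 1) - ys) (t (k + 1))
    have e2 := extrapolation_identity (w (k + 1) - ys) (y (k + 1) - ys) (t (k + 1))
    have e3 : t (k + 1) • (w (k + 1) - ys) - (t (k + 1) - 1) • (y (k + 1) - ys) =
        t k • (y (k + 1) - ys) - (t k - 1) • (y k - ys) := by
      have : t (k + 1) • w (k + 1) = t (k + 1) • y (k + 1) + (t k - 1) • (y (k + 1) - y k) := by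
        rw [hw, smul_add, smul_smul, mul_div_cancel₀ _ (by linarith : t (k + 1) ≠ 0)]
      rw [smul_sub, this]
      module
    rw [e3] at e2
    rw [sub_sub_sub_cancel_right] at e1 e2
    have h1 := (hstep (k + 1)).div (hl _) (hstep k).1
    have h2 := (hstep (k + 1)).div (hl _) hys
    have h1' := mul_le_mul_of_nonneg_left h1
      (by nlinarith : 0 ≤ t (k + 1) * (t (k + 1) - 1))
    have h2' := mul_le_mul_of_nonneg_left h2 (by linarith : 0 ≤ t (k + 1))
    have h3 : (q (y (k + 1)) - q ys) * (l (k + 1))⁻¹ ≤ (q (y (k + 1)) - q ys) * (l k)⁻¹ :=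
      mul_le_mul_of_nonneg_left (inv_anti₀ (hl k) (hmono k.le_succ))
        (sub_nonneg.2 (hmin _ (hstep k).1))
    have h4 := mul_le_mul_of_nonneg_left h3 (by positivity : 0 ≤ 2 * t k ^ 2)
    have h5 : t k ^ 2 * ((q (y (k + 1)) - q (y (k + 2))) * (l (k + 1))⁻¹) +
        t (k + 1) * ((q ys - q (y (k + 2))) * (l (k + 1))⁻¹) =
        t k ^ 2 * ((q (y (k + 1)) - q ys) * (l (k + 1))⁻¹) -
        t (k + 1) ^ 2 * ((q (y (k + 2)) - q ys) * (l (k + 1))⁻¹) := by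
      rw [← hsq]; ring
    rw [show k + 1 + 1 = k + 2 from rfl] at *
    rw [hsq] at h1' e1 e2
    linarith

theorem fast_dist_le (hl : ∀ i, 0 < l i) (hmono : Monotone l) (hw0 : w 0 = y 0) (ht0 : t 0 = 1)
    (ht : ∀ k, t (k + 1) = (1 + √(1 + 4 * t k ^ 2)) / 2)
    (hw : ∀ k, w (k + 1) = y (k + 1) + ((t k - 1) / t (k + 1)) • (y (k + 1) - y k))
    (hstep : ∀ k, StepIneq q D (l k) (w k) (y (k + 1))) {ys : V} (hys : ys ∈ D)
    (hmin : ∀ z ∈ D, q ys ≤ q z) (k : ℕ) : ‖y k - ys‖ ≤ ‖y 0 - ys‖ := by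
  induction k with
  | zero => exact le_rfl
  | succ k ih =>
    have h1 := fast_potential hl hmono hw0 ht0 ht hw hstep hys hmin k
    have hT : 1 ≤ t k := by
      have := momentum_ge ht0 ht k
      have : (0 : ℝ) ≤ k := by positivity
      linarith
    have h2 : 0 ≤ 2 * t k ^ 2 * ((q (y (k + 1)) - q ys) * (l k)⁻¹) :=
      mul_nonneg (by positivity)
        (mul_nonneg (sub_nonneg.2 (hmin _ (hstep k).1)) (inv_nonneg.2 (hl k).le))
    have h3 : ‖t k • (y (k + 1) - ys) - (t k - 1) • (y k - ys)‖ ≤ ‖y 0 - ys‖ :=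
      (sq_le_sq₀ (norm_nonneg _) (norm_nonneg _)).1 (by linarith)
    have h4 : t k * ‖y (k + 1) - ys‖ ≤ ‖y 0 - ys‖ + (t k - 1) * ‖y k - ys‖ := by
      have := norm_add_le (t k • (y (k + 1) - ys) - (t k - 1) • (y k - ys))
        ((t k - 1) • (y k - ys))
      rw [sub_add_cancel, norm_smul, norm_smul, Real.norm_of_nonneg (by linarith),
        Real.norm_of_nonneg (by linarith)] at this
      linarith
    have h5 := mul_le_mul_of_nonneg_left ih (by linarith : 0 ≤ t k - 1)
    exact le_of_mul_le_mul_left (by linarith) (by linarith : 0 < t k)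

theorem fast_displacement_le (hl : ∀ i, 0 < l i) (hmono : Monotone l) (hw0 : w 0 = y 0)
    (ht0 : t 0 = 1) (ht : ∀ k, t (k + 1) = (1 + √(1 + 4 * t k ^ 2)) / 2)
    (hw : ∀ k, w (k + 1) = y (k + 1) + ((t k - 1) / t (k + 1)) • (y (k + 1) - y k))
    (hstep : ∀ k, StepIneq q D (l k) (w k) (y (k + 1))) {ys : V} (hys : ys ∈ D)
    (hmin : ∀ z ∈ D, q ys ≤ q z) {k : ℕ} {l' : ℝ} (hl' : l k ≤ l') {p : V}
    (hp : StepIneq q D l' (y (k + 1)) p) :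
    ‖p - y (k + 1)‖ ≤ 2 * ‖y 0 - ys‖ / ((k + 1 : ℕ) : ℝ) := by
  have h1 := fast_potential hl hmono hw0 ht0 ht hw hstep hys hmin k
  have hT := momentum_ge ht0 ht k
  have hk : (0 : ℝ) ≤ k := by positivity
  have h2 := hp.div ((hl k).trans_le hl') (hstep k).1
  rw [sub_self, norm_zero] at h2
  have hv : 0 ≤ q (y (k + 1)) - q ys := sub_nonneg.2 (hmin _ (hstep k).1)
  have h3 : (q (y (k + 1)) - q p) * l'⁻¹ ≤ (q (y (k + 1)) - q ys) * (l k)⁻¹ :=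
    (mul_le_mul_of_nonneg_right (sub_le_sub_left (hmin p hp.1) _)
      (inv_nonneg.2 ((hl k).trans_le hl').le)).trans
      (mul_le_mul_of_nonneg_left (inv_anti₀ (hl k) hl') hv)
  have h4 : (((k : ℝ) + 1) / 2) ^ 2 ≤ t k ^ 2 := by gcongr; linarith
  have h5 : (((k : ℝ) + 1) / 2) ^ 2 * ‖p - y (k + 1)‖ ^ 2 ≤ t k ^ 2 * ‖p - y (k + 1)‖ ^ 2 :=
    mul_le_mul_of_nonneg_right h4 (by positivity)
  have h6 := mul_le_mul_of_nonneg_left (h2.trans h3) (by positivity : 0 ≤ 2 * t k ^ 2)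
  have h7 : 0 ≤ ‖t k • (y (k + 1) - ys) - (t k - 1) • (y k - ys)‖ ^ 2 := by positivity
  rw [le_div_iff₀ (by positivity)]
  refine (sq_le_sq₀ (by positivity) (by positivity)).1 ?_
  push_cast
  linarith

end Fast

end Abstract

end DualProx

namespace DualProx

open Set

theorem le_of_forall_Ioo_mul {x y c : ℝ} (h : ∀ b ∈ Ioo (0 : ℝ) 1, x ≤ y + b * c) : x ≤ y := by
  have h1 : Filter.Tendsto (fun b : ℝ => y + b * c) (nhdsWithin 0 (Ioi 0)) (nhds y) := by
    have : Filter.Tendsto (fun b : ℝ => y + b * c) (nhds 0) (nhds (y + 0 * c)) :=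
      Continuous.tendsto (by fun_prop) 0
    rw [zero_mul, add_zero] at this
    exact this.mono_left nhdsWithin_le_nhds
  exact ge_of_tendsto h1 (Filter.mem_of_superset (Ioo_mem_nhdsGT one_pos) h)

section Strong

variable {E : Type*} [NormedAddCommGroup E] [InnerProductSpace ℝ E] {f : E → EReal} {σ : ℝ}

theorem exists_isMinOn_of_isStronglyConvex [FiniteDimensional ℝ E] (hσ : 0 < σ)
    (hp : IsProper f) (hc : LowerSemicontinuous f) (hs : IsStronglyConvex σ f) :
    ∃ x, IsMinOn f univ x := by
  have : ProperSpace E := FiniteDimensional.proper ℝ E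
  obtain ⟨x₀, hx₀⟩ := hp.2
  obtain ⟨r₀, hr₀⟩ : ∃ r : ℝ, f x₀ = r := ⟨_, (EReal.coe_toReal hx₀ (hp.1 x₀)).symm⟩
  obtain ⟨x₁, -, h₁⟩ := (hc.lowerSemicontinuousOn _).exists_isMinOn
    ⟨x₀, Metric.mem_closedBall_self zero_le_one⟩ (isCompact_closedBall x₀ 1)
  have h₁₀ : f x₁ ≤ r₀ := hr₀ ▸ h₁ (Metric.mem_closedBall_self zero_le_one)
  obtain ⟨m, hm⟩ : ∃ m : ℝ, f x₁ = m :=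
    ⟨_, (EReal.coe_toReal (ne_top_of_le_ne_top (EReal.coe_ne_top r₀) h₁₀) (hp.1 x₁)).symm⟩
  have hm₀ : m ≤ r₀ := by rw [hm] at h₁₀; exact_mod_cast h₁₀
  have hR : 1 ≤ 1 + 2 * (r₀ - m) / σ := by
    have : 0 ≤ 2 * (r₀ - m) / σ := div_nonneg (by linarith) hσ.le
    linarith
  have hR0 : x₀ ∈ Metric.closedBall x₀ (1 + 2 * (r₀ - m) / σ) :=
    Metric.mem_closedBall_self (by linarith)
  obtain ⟨x₂, -, h₂⟩ := (hc.lowerSemicontinuousOn _).exists_isMinOn ⟨x₀, hR0⟩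
    (isCompact_closedBall x₀ (1 + 2 * (r₀ - m) / σ))
  refine ⟨x₂, fun u _ => ?_⟩
  by_cases hu : u ∈ Metric.closedBall x₀ (1 + 2 * (r₀ - m) / σ)
  · exact h₂ hu
  have h₂₀ : f x₂ ≤ f x₀ := h₂ hR0
  refine h₂₀.trans ?_
  by_contra! hlt
  rw [hr₀] at hlt
  rw [Metric.mem_closedBall, not_le, dist_eq_norm] at hu
  have hρ : 0 < ‖u - x₀‖ := by linarith
  set ρ := ‖u - x₀‖
  have hb : ρ⁻¹ ≤ 1 := inv_le_one_of_one_le₀ (by linarith)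
  have h3 := hs x₀ u r₀ r₀ (1 - ρ⁻¹) ρ⁻¹ hr₀.le hlt.le (by linarith) (by positivity) (by ring)
  have h4 : (1 - ρ⁻¹) • x₀ + ρ⁻¹ • u ∈ Metric.closedBall x₀ 1 := by
    rw [Metric.mem_closedBall, dist_eq_norm,
      show (1 - ρ⁻¹) • x₀ + ρ⁻¹ • u - x₀ = ρ⁻¹ • (u - x₀) by module, norm_smul,
      Real.norm_of_nonneg (by positivity)]
    exact (inv_mul_cancel₀ hρ.ne').le
  have h5 := (h₁ h4).trans h3
  rw [hm, EReal.coe_le_coe_iff, norm_sub_rev] at h5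
  have h6 : σ / 2 * ((1 - ρ⁻¹) * ρ⁻¹) * ρ ^ 2 = σ / 2 * (ρ - 1) := by field_simp
  change m ≤ (1 - ρ⁻¹) * r₀ + ρ⁻¹ * r₀ - σ / 2 * ((1 - ρ⁻¹) * ρ⁻¹) * ρ ^ 2 at h5
  rw [h6] at h5
  have h7 : 2 * (r₀ - m) / σ < ρ - 1 := by linarith
  rw [div_lt_iff₀ hσ] at h7
  linarith

/-- `X c` is a point where `c` is a `σ`-strong subgradient of `f`, and `r c = f (X c)`. -/
structure IsConjSelection (f : E → EReal) (σ : ℝ) (X : E → E) (r : E → ℝ) : Prop where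
  val : ∀ c, f (X c) = (r c : EReal)
  sub : ∀ c u, ((r c + inner ℝ c (u - X c) + σ / 2 * ‖u - X c‖ ^ 2 : ℝ) : EReal) ≤ f u

theorem exists_isConjSelection [FiniteDimensional ℝ E] (hσ : 0 < σ) (hp : IsProper f)
    (hc : LowerSemicontinuous f) (hs : IsStronglyConvex σ f) :
    ∃ X r, IsConjSelection f σ X r := by
  suffices H : ∀ c : E, ∃ (x : E) (r : ℝ), f x = (r : EReal) ∧
      ∀ u, ((r + inner ℝ c (u - x) + σ / 2 * ‖u - x‖ ^ 2 : ℝ) : EReal) ≤ f u by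
    choose X r h1 h2 using H
    exact ⟨X, r, h1, h2⟩
  intro c
  have key : ∀ (u : E) (s : ℝ), f u + ((-inner ℝ c u : ℝ) : EReal) ≤ s ↔
      f u ≤ ((s + inner ℝ c u : ℝ) : EReal) := by
    intro u s
    rw [EReal.coe_neg, ← sub_eq_add_neg, EReal.sub_le_iff_le_add (by simp) (by simp),
      ← EReal.coe_add]
  have hp' : IsProper fun u => f u + ((-inner ℝ c u : ℝ) : EReal) := by
    refine ⟨fun u => ?_, hp.2.imp fun u hu => ?_⟩
    · simp [EReal.add_eq_bot_iff, hp.1 u]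
    · exact EReal.add_ne_top hu (EReal.coe_ne_top _)
  have hc' : LowerSemicontinuous fun u => f u + ((-inner ℝ c u : ℝ) : EReal) := by
    refine hc.add' (Continuous.lowerSemicontinuous ?_) fun u =>
      EReal.continuousAt_add (Or.inr (EReal.coe_ne_bot _)) (Or.inr (EReal.coe_ne_top _))
    exact continuous_coe_real_ereal.comp (by fun_prop)
  have hs' : IsStronglyConvex σ fun u => f u + ((-inner ℝ c u : ℝ) : EReal) := by
    intro x u r s a b hx hu ha hb hab
    rw [key] at hx hu ⊢
    refine (hs x u _ _ a b hx hu ha hb hab).trans (EReal.coe_le_coe_iff.2 (le_of_eq ?_))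
    rw [inner_add_right, inner_smul_right, inner_smul_right]
    ring
  obtain ⟨x, hx⟩ := exists_isMinOn_of_isStronglyConvex hσ hp' hc' hs'
  obtain ⟨x₀, hx₀⟩ := hp'.2
  have hxt := ne_top_of_le_ne_top hx₀ (hx (mem_univ x₀))
  have hft : f x ≠ ⊤ := fun h => hxt (by simp [h])
  obtain ⟨r, hr⟩ : ∃ r : ℝ, f x = r := ⟨_, (EReal.coe_toReal hft (hp.1 x)).symm⟩
  refine ⟨x, r, hr, fun u => ?_⟩
  by_cases hut : f u = ⊤
  · rw [hut]; exact le_top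
  obtain ⟨s, hsu⟩ : ∃ s : ℝ, f u = s := ⟨_, (EReal.coe_toReal hut (hp.1 u)).symm⟩
  rw [hsu, EReal.coe_le_coe_iff]
  refine le_of_forall_Ioo_mul (c := σ / 2 * ‖u - x‖ ^ 2) fun b hb => ?_
  have h1 := hs x u r s (1 - b) b hr.le hsu.le (by linarith [hb.2]) hb.1.le (by ring)
  have h2 := hx (mem_univ ((1 - b) • x + b • u))
  simp only [mem_ofPred_eq, hr] at h2
  have h3 := h2.trans (add_le_add_left h1 _)
  rw [← EReal.coe_add, ← EReal.coe_add, EReal.coe_le_coe_iff, inner_add_right, inner_smul_right,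
    inner_smul_right, norm_sub_rev] at h3
  rw [inner_sub_right]
  refine le_of_mul_le_mul_left ?_ hb.1
  linarith

namespace IsConjSelection

variable {X : E → E} {r : E → ℝ}

theorem conj_eq (h : IsConjSelection f σ X r) (hσ : 0 < σ) (c : E) :
    conj f c = ((inner ℝ c (X c) - r c : ℝ) : EReal) := by
  refine le_antisymm (iSup_le fun u => ?_) ?_
  · refine (EReal.sub_le_sub le_rfl (h.sub c u)).trans ?_
    rw [← EReal.coe_sub, EReal.coe_le_coe_iff, inner_sub_right]
    have : 0 ≤ σ / 2 * ‖u - X c‖ ^ 2 := by positivity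
    linarith
  · refine le_trans ?_ (le_iSup _ (X c))
    rw [h.val, EReal.coe_sub]

theorem strong (h : IsConjSelection f σ X r) (c c' : E) :
    r c + inner ℝ c (X c' - X c) + σ / 2 * ‖X c' - X c‖ ^ 2 ≤ r c' := by
  have := h.sub c (X c')
  rwa [h.val, EReal.coe_le_coe_iff] at this

theorem mul_dist_sq_le (h : IsConjSelection f σ X r) (c c' : E) :
    σ * ‖X c' - X c‖ ^ 2 ≤ inner ℝ (c' - c) (X c' - X c) := by
  have h1 := h.strong c c'
  have h2 := h.strong c' c
  rw [norm_sub_rev, ← neg_sub (X c') (X c), inner_neg_right] at h2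
  rw [inner_sub_left]
  linarith

theorem mul_dist_le (h : IsConjSelection f σ X r) (c c' : E) :
    σ * ‖X c' - X c‖ ≤ ‖c' - c‖ := by
  have h1 := (h.mul_dist_sq_le c c').trans (real_inner_le_norm _ _)
  rcases (norm_nonneg (X c' - X c)).eq_or_lt with h0 | h0
  · rw [← h0, mul_zero]; exact norm_nonneg _
  · refine le_of_mul_le_mul_right ?_ h0
    linarith

end IsConjSelection

end Strong

section Subgrad

variable {V : Type*} [NormedAddCommGroup V] [InnerProductSpace ℝ V] {g : V → EReal}

/-- `g` is the real function `g'`, with a subgradient `d z` of norm at most `γ` at each `z`. -/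
structure IsSubgradSelection (g : V → EReal) (g' : V → ℝ) (d : V → V) (γ : ℝ) : Prop where
  val : ∀ z, g z = (g' z : EReal)
  sub : ∀ z u, g' z + inner ℝ (d z) (u - z) ≤ g' u
  norm_le : ∀ z, ‖d z‖ ≤ γ

theorem exists_isSubgradSelection (hp : IsProper g) (hb : BoundedSubgradients g) :
    ∃ g' d, IsSubgradSelection g g' d (gammaG g) := by
  choose d hd using hb.1
  obtain ⟨u, hu⟩ := hp.2
  have ht : ∀ z, g z ≠ ⊤ := by
    intro z hz
    have := hd z u
    rw [hz, EReal.top_add_coe, top_le_iff] at this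
    exact hu this
  have hval : ∀ z, g z = ((g z).toReal : EReal) := fun z => (EReal.coe_toReal (ht z) (hp.1 z)).symm
  refine ⟨fun z => (g z).toReal, d, hval, fun z u => ?_, fun z => ?_⟩
  · have := hd z u
    rw [hval z, hval u] at this
    exact_mod_cast this
  · exact le_csSup hb.2 ⟨z, d z, hd z, rfl⟩

/-- The effective domain of `G`. -/
def domG (g : V → EReal) : Set V := {y | dualG g y ≠ ⊤}

/-- The real value of `G` on its effective domain. -/
noncomputable def realG (g : V → EReal) (y : V) : ℝ := (dualG g y).toReal

namespace IsSubgradSelection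

variable {g' : V → ℝ} {d : V → V} {γ : ℝ}

theorem coe_le_dualG (h : IsSubgradSelection g g' d γ) (y z : V) :
    ((inner ℝ (-y) z - g' z : ℝ) : EReal) ≤ dualG g y := by
  rw [EReal.coe_sub, ← h.val]
  exact le_iSup (fun z => ((inner ℝ (-y) z : ℝ) : EReal) - g z) z

theorem dualG_eq (h : IsSubgradSelection g g' d γ) {y : V} (hy : y ∈ domG g) :
    dualG g y = (realG g y : EReal) :=
  (EReal.coe_toReal hy (ne_bot_of_le_ne_bot (EReal.coe_ne_bot _) (h.coe_le_dualG y 0))).symm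

theorem le_realG (h : IsSubgradSelection g g' d γ) {y : V} (hy : y ∈ domG g) (z : V) :
    inner ℝ (-y) z - g' z ≤ realG g y := by
  have := h.coe_le_dualG y z
  rwa [h.dualG_eq hy, EReal.coe_le_coe_iff] at this

theorem realG_le (h : IsSubgradSelection g g' d γ) {y : V} {M : ℝ}
    (hM : ∀ z, inner ℝ (-y) z - g' z ≤ M) : y ∈ domG g ∧ realG g y ≤ M := by
  have h1 : dualG g y ≤ M := iSup_le fun z => by
    rw [h.val, ← EReal.coe_sub]
    exact_mod_cast hM z
  have h2 : y ∈ domG g := ne_top_of_le_ne_top (EReal.coe_ne_top M) h1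
  rw [h.dualG_eq h2] at h1
  exact ⟨h2, by exact_mod_cast h1⟩

theorem neg_subgrad_mem (h : IsSubgradSelection g g' d γ) (v : V) :
    -d v ∈ domG g ∧ realG g (-d v) ≤ inner ℝ (d v) v - g' v := by
  refine h.realG_le fun z => ?_
  have := h.sub v z
  rw [inner_sub_right] at this
  rw [neg_neg]
  linarith

theorem realG_convex (h : IsSubgradSelection g g' d γ) {y z : V} (hy : y ∈ domG g)
    (hz : z ∈ domG g) {b : ℝ} (hb : b ∈ Ioo (0 : ℝ) 1) :
    y + b • (z - y) ∈ domG g ∧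
      realG g (y + b • (z - y)) ≤ (1 - b) * realG g y + b * realG g z := by
  refine h.realG_le fun u => ?_
  have h1 := mul_le_mul_of_nonneg_left (h.le_realG hy u) (by linarith [hb.2] : 0 ≤ 1 - b)
  have h2 := mul_le_mul_of_nonneg_left (h.le_realG hz u) hb.1.le
  rw [inner_neg_left] at h1 h2 ⊢
  rw [inner_add_left, inner_smul_left, inner_sub_left]
  simp only [conj_trivial]
  linarith

end IsSubgradSelection

end Subgrad

section Dual

variable {E V : Type*} [NormedAddCommGroup E] [InnerProductSpace ℝ E] [CompleteSpace E]
  [NormedAddCommGroup V] [InnerProductSpace ℝ V] [CompleteSpace V]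
  {f : E → EReal} {g : V → EReal} {A : E →L[ℝ] V} {σ : ℝ} {X : E → E} {r : E → ℝ}

local notation "dual" => ContinuousLinearMap.adjoint

/-- The real value of `F(y)` computed from the selection of maximizers. -/
noncomputable def smoothVal (A : E →L[ℝ] V) (X : E → E) (r : E → ℝ) (y : V) : ℝ :=
  inner ℝ (dual A y) (X (dual A y)) - r (dual A y)

/-- The gradient of `F` computed from the selection of maximizers. -/
noncomputable def smoothGrad (A : E →L[ℝ] V) (X : E → E) (y : V) : V := A (X (dual A y))

namespace IsConjSelection

theorem dualF_eq (h : IsConjSelection f σ X r) (hσ : 0 < σ) (y : V) :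
    dualF f A y = (smoothVal A X r y : EReal) := h.conj_eq hσ _

theorem smoothVal_ge (h : IsConjSelection f σ X r) (hσ : 0 < σ) (w y : V) :
    smoothVal A X r w + inner ℝ (y - w) (smoothGrad A X w) ≤ smoothVal A X r y := by
  have h1 := h.strong (dual A y) (dual A w)
  have h2 : 0 ≤ σ / 2 * ‖X (dual A w) - X (dual A y)‖ ^ 2 := by positivity
  rw [inner_sub_right] at h1
  simp only [smoothVal, smoothGrad, ← ContinuousLinearMap.adjoint_inner_left, map_sub,
    inner_sub_left]
  linarith

theorem norm_smoothGrad_sub_le (h : IsConjSelection f σ X r) (hσ : 0 < σ) (w y : V) :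
    ‖smoothGrad A X y - smoothGrad A X w‖ ≤ lipF A σ * ‖y - w‖ := by
  have h1 := h.mul_dist_le (dual A w) (dual A y)
  have h2 : ‖dual A y - dual A w‖ ≤ ‖A‖ * ‖y - w‖ := by
    rw [← map_sub]
    exact ((dual A).le_opNorm _).trans_eq (by rw [LinearIsometryEquiv.norm_map])
  have h3 : ‖smoothGrad A X y - smoothGrad A X w‖ ≤ ‖A‖ * ‖X (dual A y) - X (dual A w)‖ := by
    rw [smoothGrad, smoothGrad, ← map_sub]
    exact A.le_opNorm _
  refine h3.trans ?_
  rw [lipF, div_mul_eq_mul_div, le_div_iff₀ hσ]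
  have h4 := mul_le_mul_of_nonneg_left (h1.trans h2) (norm_nonneg A)
  linarith

theorem hasGradientAt_smoothVal (h : IsConjSelection f σ X r) (hσ : 0 < σ) (w : V) :
    HasGradientAt (smoothVal A X r) (smoothGrad A X w) w := by
  rw [hasGradientAt_iff_isLittleO]
  have hO : (fun y => smoothVal A X r y - smoothVal A X r w - inner ℝ (smoothGrad A X w) (y - w))
      =O[nhds w] fun y => ‖y - w‖ ^ 2 := by
    refine Asymptotics.IsBigO.of_bound (lipF A σ) (Filter.Eventually.of_forall fun y => ?_)
    have h1 := h.smoothVal_ge (A := A) hσ w y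
    have h2 := h.smoothVal_ge (A := A) hσ y w
    have h3 : inner ℝ (y - w) (smoothGrad A X y - smoothGrad A X w) ≤ lipF A σ * ‖y - w‖ ^ 2 := by
      refine (real_inner_le_norm _ _).trans ?_
      have := mul_le_mul_of_nonneg_left (h.norm_smoothGrad_sub_le (A := A) hσ w y)
        (norm_nonneg (y - w))
      linarith
    rw [← neg_sub y w, inner_neg_left] at h2
    rw [inner_sub_right] at h3
    rw [real_inner_comm, Real.norm_of_nonneg (by linarith), Real.norm_of_nonneg (by positivity)]
    linarith
  refine hO.trans_isLittleO ?_
  have h4 : (fun y => y - w) =o[nhds w] fun _ => (1 : ℝ) := by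
    rw [Asymptotics.isLittleO_one_iff]
    exact Continuous.tendsto' (by fun_prop) _ _ (sub_self w)
  have h5 := h4.norm_norm.mul_isBigO (Asymptotics.isBigO_refl (fun y => ‖y - w‖) (nhds w))
  simpa [pow_two] using h5.norm_right

theorem gradF_eq (h : IsConjSelection f σ X r) (hσ : 0 < σ) (w : V) :
    gradF f A w = smoothGrad A X w := by
  have : (fun y => (dualF f A y).toReal) = smoothVal A X r := by
    funext y
    rw [h.dualF_eq hσ, EReal.toReal_coe]
  rw [gradF, this]
  exact (h.hasGradientAt_smoothVal hσ w).gradient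

theorem isPrimalPoint_iff (h : IsConjSelection f σ X r) (hσ : 0 < σ) (y : V) (x : E) :
    IsPrimalPoint f A y x ↔ x = X (dual A y) := by
  constructor
  · intro hx
    have h1 := hx (mem_univ (X (dual A y)))
    simp only [mem_ofPred_eq, h.val] at h1
    have h2 := h1.trans (EReal.sub_le_sub le_rfl (h.sub (dual A y) x))
    rw [← EReal.coe_sub, ← EReal.coe_sub, EReal.coe_le_coe_iff, inner_sub_right] at h2
    have h3 : ‖x - X (dual A y)‖ ^ 2 ≤ 0 := by
      by_contra! hpos
      have := mul_pos (half_pos hσ) hpos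
      linarith
    exact sub_eq_zero.1 (norm_eq_zero.1 (pow_eq_zero_iff two_ne_zero |>.1
      (le_antisymm h3 (by positivity))))
  · rintro rfl u -
    have h1 : ((inner ℝ (dual A y) u : ℝ) : EReal) - f u ≤ conj f (dual A y) :=
      le_iSup (fun u => ((inner ℝ (dual A y) u : ℝ) : EReal) - f u) u
    rw [h.conj_eq hσ, EReal.coe_sub] at h1
    simpa only [mem_ofPred_eq, h.val] using h1

end IsConjSelection

section Model

variable {g' : V → ℝ} {d : V → V} {γ l : ℝ} {w p : V}

theorem quadModel_eq (hX : IsConjSelection f σ X r) (hσ : 0 < σ)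
    (hg : IsSubgradSelection g g' d γ) {y : V} (hy : y ∈ domG g) :
    quadModel f g A l y w = ((smoothVal A X r w + (inner ℝ (y - w) (smoothGrad A X w) +
      l / 2 * ‖y - w‖ ^ 2) + realG g y : ℝ) : EReal) := by
  rw [quadModel, hX.dualF_eq hσ, hX.gradF_eq hσ, hg.dualG_eq hy]
  push_cast
  rfl

theorem IsProxGrad.mem_domG (hX : IsConjSelection f σ X r) (hσ : 0 < σ)
    (hg : IsSubgradSelection g g' d γ) (hp : IsProxGrad f g A l w p) : p ∈ domG g := by
  intro ht
  have hy := (hg.neg_subgrad_mem 0).1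
  have h1 := hp (mem_univ (-d 0))
  simp only [mem_ofPred_eq, quadModel_eq hX hσ hg hy] at h1
  rw [quadModel, ht, hX.dualF_eq hσ, ← EReal.coe_add, EReal.coe_add_top, top_le_iff] at h1
  exact EReal.coe_ne_top _ h1

/-- First-order optimality condition of the proximal gradient step. -/
theorem IsProxGrad.realG_ge (hX : IsConjSelection f σ X r) (hσ : 0 < σ)
    (hg : IsSubgradSelection g g' d γ) (hp : IsProxGrad f g A l w p) {y : V} (hy : y ∈ domG g) :
    realG g p ≤ realG g y + inner ℝ (y - p) (smoothGrad A X w + l • (p - w)) := by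
  have hpD := hp.mem_domG hX hσ hg
  refine le_of_forall_Ioo_mul (c := l / 2 * ‖y - p‖ ^ 2) fun b hb => ?_
  have hc := hg.realG_convex hpD hy hb
  have h1 := hp (mem_univ (p + b • (y - p)))
  simp only [mem_ofPred_eq] at h1
  rw [quadModel_eq hX hσ hg hpD, quadModel_eq hX hσ hg hc.1, EReal.coe_le_coe_iff,
    show p + b • (y - p) - w = (p - w) + b • (y - p) by abel, norm_add_sq_real, norm_smul,
    inner_add_left, inner_smul_left, inner_smul_right, mul_pow, Real.norm_eq_abs, sq_abs,
    real_inner_comm (y - p) (p - w)] at h1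
  simp only [conj_trivial] at h1
  rw [inner_add_right, inner_smul_right]
  refine le_of_mul_le_mul_left ?_ hb.1
  linarith [hc.2]

theorem IsAcceptedStep.stepIneq (hX : IsConjSelection f σ X r) (hσ : 0 < σ)
    (hg : IsSubgradSelection g g' d γ) (hp : IsAcceptedStep f g A l w p) :
    StepIneq (fun y => smoothVal A X r y + realG g y) (domG g) l w p := by
  have hpD := hp.1.mem_domG hX hσ hg
  refine ⟨hpD, fun y hy => ?_⟩
  have h1 := hp.1.realG_ge hX hσ hg hy
  have h2 := hp.2
  rw [dualObj, quadModel_eq hX hσ hg hpD, hX.dualF_eq hσ, hg.dualG_eq hpD, ← EReal.coe_add,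
    EReal.coe_le_coe_iff] at h2
  have h3 := hX.smoothVal_ge (A := A) hσ w y
  rw [show w - y = (p - y) - (p - w) by abel, norm_sub_sq_real (p - y)]
  rw [show y - w = (y - p) + (p - w) by abel, inner_add_left] at h3
  rw [inner_add_right, inner_smul_right, ← neg_sub p y, inner_neg_left, inner_neg_left] at h1
  rw [← neg_sub p y, inner_neg_left] at h3
  linarith

theorem coe_le_dualFun (hX : IsConjSelection f σ X r) (hσ : 0 < σ)
    (hg : IsSubgradSelection g g' d γ) {y : V} (hy : y ∈ domG g) :
    ((-(smoothVal A X r y + realG g y) : ℝ) : EReal) ≤ dualFun f g A y := by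
  refine le_iInf₂ fun x z => ?_
  have h1 := add_le_add_left (hX.sub (dual A y) x) (g z)
  have h2 := EReal.sub_le_sub h1 (le_refl ((inner ℝ y (A x - z) : ℝ) : EReal))
  refine le_trans ?_ h2
  rw [hg.val, ← EReal.coe_add, ← EReal.coe_sub, EReal.coe_le_coe_iff]
  have h3 := hg.le_realG hy z
  have h4 : 0 ≤ σ / 2 * ‖x - X (dual A y)‖ ^ 2 := by positivity
  rw [inner_neg_left] at h3
  rw [smoothVal, inner_sub_right, inner_sub_right, ← ContinuousLinearMap.adjoint_inner_left]
  linarith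

theorem mem_domG_of_coe_le_dualFun (hX : IsConjSelection f σ X r)
    (hg : IsSubgradSelection g g' d γ) {y : V} {m : ℝ} (hm : (m : EReal) ≤ dualFun f g A y) :
    y ∈ domG g ∧ smoothVal A X r y + realG g y ≤ -m := by
  have h1 : y ∈ domG g ∧ realG g y ≤ -m - smoothVal A X r y := hg.realG_le fun z => by
    have h2 := hm.trans (iInf₂_le (X (dual A y)) z)
    rw [hX.val, hg.val, ← EReal.coe_add, ← EReal.coe_sub, EReal.coe_le_coe_iff,
      inner_sub_right, ← ContinuousLinearMap.adjoint_inner_left] at h2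
    rw [smoothVal, inner_neg_left]
    linarith
  exact ⟨h1.1, by linarith⟩

theorem isMinOn_of_isMaxOn_dualFun (hX : IsConjSelection f σ X r) (hσ : 0 < σ)
    (hg : IsSubgradSelection g g' d γ) {ys : V} (hys : IsMaxOn (dualFun f g A) univ ys) :
    ys ∈ domG g ∧ ∀ z ∈ domG g,
      smoothVal A X r ys + realG g ys ≤ smoothVal A X r z + realG g z := by
  have key : ∀ z ∈ domG g, ys ∈ domG g ∧
      smoothVal A X r ys + realG g ys ≤ smoothVal A X r z + realG g z := fun z hz => by
    simpa using
      mem_domG_of_coe_le_dualFun hX hg ((coe_le_dualFun hX hσ hg hz).trans (hys (mem_univ z)))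
  exact ⟨(key _ (hg.neg_subgrad_mem 0).1).1, fun z hz => (key z hz).2⟩

/-- The primal-dual gap is controlled by the length of the proximal gradient step. -/
theorem gap_le (hX : IsConjSelection f σ X r) (hσ : 0 < σ)
    (hg : IsSubgradSelection g g' d γ) (hl : 0 ≤ l) (hp : IsProxGrad f g A l w p) :
    r (dual A p) + g' (smoothGrad A X p) + (smoothVal A X r p + realG g p) ≤
      (l + lipF A σ) * (‖p‖ + γ) * ‖p - w‖ := by
  set v := smoothGrad A X w + l • (p - w)
  have hd := hg.neg_subgrad_mem v
  have h1 := hp.realG_ge hX hσ hg hd.1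
  have h2 := hg.sub (smoothGrad A X p) v
  have h3 : ‖smoothGrad A X p - v‖ ≤ (l + lipF A σ) * ‖p - w‖ := by
    rw [show smoothGrad A X p - v = (smoothGrad A X p - smoothGrad A X w) - l • (p - w) by
      simp only [v]; abel]
    refine (norm_sub_le _ _).trans ?_
    rw [norm_smul, Real.norm_of_nonneg hl]
    linarith [hX.norm_smoothGrad_sub_le (A := A) hσ w p]
  have h4 : inner ℝ (dual A p) (X (dual A p)) = inner ℝ p (smoothGrad A X p) :=
    ContinuousLinearMap.adjoint_inner_left _ _ _
  have h5 := real_inner_le_norm (p + d (smoothGrad A X p)) (smoothGrad A X p - v)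
  have h6 : ‖p + d (smoothGrad A X p)‖ * ‖smoothGrad A X p - v‖ ≤
      (‖p‖ + γ) * ((l + lipF A σ) * ‖p - w‖) := by
    have := hg.norm_le (smoothGrad A X p)
    have h0 := norm_nonneg (d (smoothGrad A X p))
    refine mul_le_mul ((norm_add_le _ _).trans (by linarith)) h3 (norm_nonneg _) ?_
    have := norm_nonneg p
    linarith
  rw [inner_sub_left, inner_neg_left] at h1
  rw [inner_add_left, inner_sub_right, inner_sub_right] at h5
  rw [inner_sub_right] at h2
  rw [smoothVal, h4]
  linarith [hd.2]

theorem gapLE_of_isProxGrad (hX : IsConjSelection f σ X r) (hσ : 0 < σ)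
    (hg : IsSubgradSelection g g' d γ) (hl : 0 ≤ l) (hp : IsProxGrad f g A l w p) {M N : ℝ}
    (hM : ‖p‖ ≤ M) (hN : ‖p - w‖ ≤ N) :
    GapLE f g A p ((l + lipF A σ) * (M + γ) * N) := by
  refine ⟨⟨X (dual A p), (hX.isPrimalPoint_iff hσ p _).2 rfl,
    fun x hx => (hX.isPrimalPoint_iff hσ p x).1 hx⟩, fun x hx => ?_⟩
  obtain rfl := (hX.isPrimalPoint_iff hσ p x).1 hx
  have hγ : 0 ≤ γ := (norm_nonneg _).trans (hg.norm_le 0)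
  have hlip : 0 ≤ lipF A σ := by unfold lipF; positivity
  have hM0 : 0 ≤ M := (norm_nonneg _).trans hM
  have h1 : primalObj f g A (X (dual A p)) - dualFun f g A p ≤
      (((l + lipF A σ) * (M + γ) * N : ℝ) : EReal) := by
    refine (EReal.sub_le_sub le_rfl (coe_le_dualFun hX hσ hg (hp.mem_domG hX hσ hg))).trans ?_
    rw [primalObj, hX.val, hg.val, ← EReal.coe_add, ← EReal.coe_sub, EReal.coe_le_coe_iff,
      sub_neg_eq_add]
    refine (gap_le hX hσ hg hl hp).trans ?_
    gcongr
  refine ⟨h1, fun xs _ => (EReal.sub_le_sub le_rfl ?_).trans h1⟩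
  refine (iInf₂_le xs (A xs)).trans ?_
  rw [sub_self, inner_zero_right, EReal.coe_zero, sub_zero, primalObj]

end Model

end Dual

end DualProx

namespace DualProx

open Set

section Abstract

variable {V : Type*} [NormedAddCommGroup V] {q : V → ℝ} {D : Set V} {L : ℕ → ℝ} {y : ℕ → V}

/-- `displacement_le` for a last step taken with its own step parameter. -/
theorem displacement_extra_step_le (hL : ∀ i, 0 < L i) (hmono : Monotone L)
    (hstep : ∀ i, StepIneq q D (L (i + 1)) (y i) (y (i + 1))) {ys : V} (hys : ys ∈ D)
    (hmin : ∀ z ∈ D, q ys ≤ q z) {k : ℕ} (hk : 1 ≤ k) {L' : ℝ} (hL' : L k ≤ L') {p : V}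
    (hp : StepIneq q D L' (y k) p) : ‖p - y k‖ ≤ 2 * ‖y 0 - ys‖ / k := by
  have h := displacement_le (q := q) (D := D) (l := fun i => if i < k then L (i + 1) else L')
    (y := fun i => if i ≤ k then y i else p) (k := k) (ys := ys) ?_ ?_ hk ?_ hys hmin
  · simpa using h
  · intro i
    split_ifs
    · exact hL _
    · exact (hL k).trans_le hL'
  · refine monotone_nat_of_le_succ fun i => ?_
    by_cases h1 : i + 1 < k
    · simp only [h1, (Nat.lt_succ_self i).trans h1, if_true]
      exact hmono (Nat.le_succ _)
    · by_cases h2 : i < k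
      · simp only [h1, h2, if_true, if_false]
        exact (hmono (by omega)).trans hL'
      · simp [h1, h2]
  · intro i hi
    rcases hi.lt_or_eq with h1 | rfl
    · simpa [h1, h1.le, Nat.succ_le_of_lt h1] using hstep i
    · simpa using hp

end Abstract

end DualProx

theorem mainTheorem5
    {E V : Type*} [NormedAddCommGroup E] [InnerProductSpace ℝ E] [FiniteDimensional ℝ E]
    [CompleteSpace E]
    [NormedAddCommGroup V] [InnerProductSpace ℝ V] [FiniteDimensional ℝ V] [CompleteSpace V]
    (f : E → EReal) (g : V → EReal) (A : E →L[ℝ] V) (σ : ℝ) (hσ : 0 < σ)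
    (hf_proper : DualProx.IsProper f) (hf_closed : LowerSemicontinuous f)
    (hf_conv : DualProx.IsStronglyConvex σ f)
    (hg_proper : DualProx.IsProper g) (hg_closed : LowerSemicontinuous g)
    (hg_conv : DualProx.IsStronglyConvex 0 g)
    (hg_subgrad : DualProx.BoundedSubgradients g)
    (ystar : V) (hystar : IsMaxOn (DualProx.dualFun f g A) Set.univ ystar)
    (L : ℕ → ℝ) (y : ℕ → V)
    (hy : DualProx.IsDPG f g A L y ∨ ∃ w t, DualProx.IsFDPG f g A L y w t) :
    (∀ k : ℕ, 1 ≤ k → ∀ (L' : ℝ) (p : V), L k ≤ L' →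
      DualProx.IsAcceptedStep f g A L' (y k) p →
      DualProx.GapLE f g A p (DualProx.gapBound g A σ L' (y 0) ystar k)) ∧
    (DualProx.IsDPG f g A L y → ∀ k : ℕ, 1 ≤ k →
      DualProx.GapLE f g A (y (k + 1))
        (DualProx.gapBound g A σ (L (k + 1)) (y 0) ystar k)) := by
  obtain ⟨X, r, hX⟩ := DualProx.exists_isConjSelection hσ hf_proper hf_closed hf_conv
  obtain ⟨g', d, hg⟩ := DualProx.exists_isSubgradSelection hg_proper hg_subgrad
  obtain ⟨hys, hmin⟩ := DualProx.isMinOn_of_isMaxOn_dualFun hX hσ hg hystar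
  have hmono : Monotone L :=
    monotone_nat_of_le_succ (hy.elim (fun h => h.L_mono) fun ⟨_, _, h⟩ => h.L_mono)
  have hL : ∀ i, 0 < L i := fun i =>
    (hy.elim (fun h => h.L_pos) fun ⟨_, _, h⟩ => h.L_pos).trans_le (hmono (Nat.zero_le i))
  have main : ∀ k : ℕ, 1 ≤ k → ∀ (L' : ℝ) (p : V), L k ≤ L' →
      DualProx.IsAcceptedStep f g A L' (y k) p →
      DualProx.GapLE f g A p (DualProx.gapBound g A σ L' (y 0) ystar k) := by
    intro k hk L' p hL' hp
    have hL'0 : 0 < L' := (hL k).trans_le hL'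
    have hs := hp.stepIneq hX hσ hg
    have key : ‖y k - ystar‖ ≤ ‖y 0 - ystar‖ ∧ ‖p - y k‖ ≤ 2 * ‖y 0 - ystar‖ / k := by
      rcases hy with hy | ⟨w, t, hy⟩
      · have hstep := fun i => (hy.step i).stepIneq hX hσ hg
        exact ⟨DualProx.dist_le_of_steps (fun i => hL (i + 1)) hys hmin k fun i _ => hstep i,
          DualProx.displacement_extra_step_le hL hmono hstep hys hmin hk hL' hs⟩
      · have hstep := fun i => (hy.step i).stepIneq hX hσ hg
        have hmono' : Monotone fun i => L (i + 1) := fun i j h => hmono (by omega)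
        obtain ⟨k, rfl⟩ := Nat.exists_eq_add_of_le' hk
        exact ⟨DualProx.fast_dist_le (fun i => hL (i + 1)) hmono' hy.w_zero hy.t_zero hy.t_succ
            hy.w_succ hstep hys hmin (k + 1),
          DualProx.fast_displacement_le (fun i => hL (i + 1)) hmono' hy.w_zero hy.t_zero hy.t_succ
            hy.w_succ hstep hys hmin hL' hs⟩
    have hpn : ‖p‖ ≤ ‖y 0 - ystar‖ + ‖ystar‖ := by
      have h1 := norm_add_le (p - ystar) ystar
      rw [sub_add_cancel] at h1
      linarith [hs.dist_le hL'0 hys hmin, key.1]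
    exact DualProx.gapLE_of_isProxGrad hX hσ hg hL'0.le hp.1 hpn key.2
  exact ⟨main, fun h k hk => main k hk _ _ (hmono k.le_succ) (h.step k)⟩
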